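/- Let $H$ be a complex Hilbert space and let $\mathcal U\subseteq B(H)$ be a norm-closed linear subspace containing the identity operator $I$. Let $C^*(\mathcal U)$ denote the $C^*$-subalgebra of $B(H)$ generated by $\mathcal U$, and let $C^*(\mathcal U)'=\{T\in B(H): TA=AT \text{ for all } A\in C^*(\mathcal U)\}$ be its commutant. Suppose that there is a set $\mathcal S$ of compact operators belonging to $C^*(\mathcal U)$ such that $KT\in\mathcal U$ for all $K\in\mathcal S$ and $T\in C^*(\mathcal U)'$, and such that $I$ belongs to the closure in the weak operator topology of the linear span of $\mathcal S+\mathcal S^*=\{K+L^*: K,L\in\mathcal S\}$. Then $\mathcal U$ has the trivial intersection property: every norm-closed two-sided ideal $J$ of $C^*(\mathcal U)$ with $\mathcal U\cap J=\{0\}$ is $\{0\}$. -/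

import Mathlib

open scoped Pointwise

/-- `C*(U)`: the norm-closed unital `*`-subalgebra of `B(H)` generated by `U`.
(For `U` containing the identity operator this is the `C*`-algebra generated by `U`.) -/
noncomputable def cstarGenerated {H : Type*} [NormedAddCommGroup H] [InnerProductSpace ℂ H]
    [CompleteSpace H] (U : Submodule ℂ (H →L[ℂ] H)) : StarSubalgebra ℂ (H →L[ℂ] H) :=
  (StarAlgebra.adjoin ℂ (U : Set (H →L[ℂ] H))).topologicalClosure

/-- The trivial intersection property of a concrete unital operator space `U ⊆ B(H)`:
every norm-closed two-sided ideal `J` of `C*(U)` with `U ∩ J = {0}` is zero. -/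
def HasTrivialIntersectionProperty {H : Type*} [NormedAddCommGroup H] [InnerProductSpace ℂ H]
    [CompleteSpace H] (U : Submodule ℂ (H →L[ℂ] H)) : Prop :=
  ∀ J : Ideal (cstarGenerated U), J.IsTwoSided → IsClosed (J : Set (cstarGenerated U)) →
    (U : Set (H →L[ℂ] H)) ∩ ((fun x : cstarGenerated U => (x : H →L[ℂ] H)) '' J) = {0} →
    J = ⊥

/-- The closure in the weak operator topology of a set of bounded operators. -/
def wotClosure {H : Type*} [NormedAddCommGroup H] [InnerProductSpace ℂ H]
    (V : Set (H →L[ℂ] H)) : Set (H →L[ℂ] H) :=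
  {T | ContinuousLinearMapWOT.ofCLM T ∈
    closure ((fun A : H →L[ℂ] H => (ContinuousLinearMapWOT.ofCLM A : H →WOT[ℂ] H)) '' V)}

open Filter Topology

section ApproximateUnit

variable {B : Type*} [CStarAlgebra B] [PartialOrder B] [StarOrderedRing B]

/-! Let `e` project onto the closed span of the ranges of the operators in `J`. This subspace is
invariant under `C*(U)`, so `e` lies in the commutant, and `e * j = j` on `J`. A self-adjoint
approximate unit of `J` converges strongly to `e`; multiplied by a compact `K` in `C*(U)` it
converges in norm, so `e * K` lies in `J` (`starProjection_essentialSubspace_mul_mem`). For `K ∈ S`,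
`K * e = e * K` is thus in `U ∩ J = {0}`. Adjoints, linearity and WOT-closure then give `e = 1 * e =
0`, hence `J = 0`. -/

theorem natCast_mul_mul_one_sub_pow_le_one {t : ℝ} (h0 : 0 ≤ t) (h1 : t ≤ 1) (n : ℕ) :
    n * (t * ((1 - t) ^ n * (1 - t) ^ n)) ≤ 1 := by
  have hp : 0 ≤ (1 - t) ^ n := pow_nonneg (by linarith) n
  have hp1 : (1 - t) ^ n ≤ 1 := pow_le_one₀ (by linarith) (by linarith)
  -- Bernoulli's inequality absorbs `n * t` into `(1 + t) ^ n`, which one factor `(1 - t) ^ n`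
  -- cancels.
  have hb : 1 + (n : ℝ) * t ≤ (1 + t) ^ n := one_add_mul_le_pow (by linarith) n
  have hprod : (1 - t) ^ n * (1 + t) ^ n ≤ 1 := by
    rw [← mul_pow]
    exact pow_le_one₀ (by nlinarith) (by nlinarith)
  have hnt : 0 ≤ (n : ℝ) * t := by positivity
  calc n * (t * ((1 - t) ^ n * (1 - t) ^ n))
      = (1 - t) ^ n * (n * t) * (1 - t) ^ n := by ring
    _ ≤ (1 - t) ^ n * (n * t) * 1 := by gcongr
    _ ≤ (1 - t) ^ n * (1 + t) ^ n := by rw [mul_one]; gcongr; linarith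
    _ ≤ 1 := hprod

theorem norm_one_sub_pow_le_one {b : B} (h0 : 0 ≤ b) (h1 : b ≤ 1) (n : ℕ) :
    ‖(1 - b) ^ n‖ ≤ 1 := by
  have h : ‖1 - b‖ ≤ 1 :=
    (CStarAlgebra.norm_le_one_iff_of_nonneg _ (sub_nonneg.2 h1)).2 (by simpa using h0)
  rcases subsingleton_or_nontrivial B with _ | _
  · simp [Subsingleton.elim ((1 - b) ^ n) 0]
  · exact (norm_pow_le _ n).trans (pow_le_one₀ (norm_nonneg _) h)

theorem norm_one_sub_pow_conj_le {b : B} (h0 : 0 ≤ b) (h1 : b ≤ 1) {n : ℕ} (hn : 0 < n) :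
    ‖(1 - b) ^ n * b * (1 - b) ^ n‖ ≤ 1 / n := by
  have hsa : IsSelfAdjoint b := .of_nonneg h0
  have key : cfc (fun t : ℝ => (1 - t) ^ n * t * (1 - t) ^ n) b
      = (1 - b) ^ n * b * (1 - b) ^ n := by
    rw [cfc_mul _ _ b, cfc_mul _ _ b, cfc_pow _ n b, cfc_sub _ _ b, cfc_const_one ℝ b,
      cfc_id' ℝ b]
  rw [← key]
  refine norm_cfc_le (by positivity) fun t ht => ?_
  have ht0 : 0 ≤ t := spectrum_nonneg_of_nonneg h0 ht
  have ht1 : t ≤ 1 := (CFC.le_one_iff (R := ℝ) b).1 h1 t ht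
  have hp : 0 ≤ (1 - t) ^ n := pow_nonneg (by linarith) n
  have hn' : (0 : ℝ) < n := by exact_mod_cast hn
  rw [Real.norm_of_nonneg (by positivity), le_div_iff₀ hn']
  have := natCast_mul_mul_one_sub_pow_le_one ht0 ht1 n
  linarith

/-- By the C*-identity the square is the norm of the conjugate of `j * star j` by `(1 - b) ^ n`,
which order monotonicity compares with the conjugate of `b`. -/
theorem norm_one_sub_pow_mul_sq_le {b j : B} {s : ℝ} (hs : 0 < s) (h0 : 0 ≤ b) (h1 : b ≤ 1)
    (hj : s • (j * star j) ≤ b) {n : ℕ} (hn : 0 < n) :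
    ‖(1 - b) ^ n * j‖ ^ 2 ≤ 1 / (s * n) := by
  have hsa : IsSelfAdjoint ((1 - b) ^ n) := ((IsSelfAdjoint.one B).sub (.of_nonneg h0)).pow n
  have hle := hsa.conjugate_le_conjugate hj
  have hnn : 0 ≤ (1 - b) ^ n * (s • (j * star j)) * (1 - b) ^ n :=
    hsa.conjugate_nonneg (smul_nonneg hs.le (mul_star_self_nonneg j))
  have hnorm := (CStarAlgebra.norm_le_norm_of_nonneg_of_le hnn hle).trans
    (norm_one_sub_pow_conj_le h0 h1 hn)
  have heq : (1 - b) ^ n * (s • (j * star j)) * (1 - b) ^ n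
      = s • ((1 - b) ^ n * j * star ((1 - b) ^ n * j)) := by
    rw [star_mul, hsa.star_eq]
    simp only [mul_smul_comm, smul_mul_assoc, mul_assoc]
  rw [heq, norm_smul, CStarRing.norm_self_mul_star, Real.norm_of_nonneg hs.le] at hnorm
  have hn' : (0 : ℝ) < n := by exact_mod_cast hn
  rw [le_div_iff₀ hn'] at hnorm
  rw [le_div_iff₀ (by positivity)]
  linarith

theorem Ideal.one_sub_one_sub_pow_mem {R : Type*} [Ring R] (J : Ideal R) {b : R} (hb : b ∈ J)
    (n : ℕ) : 1 - (1 - b) ^ n ∈ J := by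
  induction n with
  | zero => simp
  | succ n ih =>
    have : 1 - (1 - b) ^ (n + 1) = (1 - (1 - b) ^ n) + (1 - b) ^ n * b := by
      rw [pow_succ]; noncomm_ring
    rw [this]
    exact J.add_mem ih (J.mul_mem_left _ hb)

/-- Taking `u` polynomial in `b`, without constant term, keeps it in `J` although neither `A` nor
`J` is assumed closed. -/
theorem exists_mem_ideal_norm_one_sub_mul_le (A : StarSubalgebra ℂ B) (J : Ideal A)
    [J.IsTwoSided] (F : Finset J) {ε : ℝ} (hε : 0 < ε) :
    ∃ u ∈ J, IsSelfAdjoint (u : B) ∧ ‖1 - (u : B)‖ ≤ 1 ∧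
      ∀ j ∈ F, ‖(1 - (u : B)) * ((j : A) : B)‖ ≤ ε := by
  set a : A := ∑ j ∈ F, (j : A) * star (j : A) with ha
  have haJ : a ∈ J := J.sum_mem fun j _ => J.mul_mem_right _ j.2
  have hac : (a : B) = ∑ j ∈ F, ((j : A) : B) * star ((j : A) : B) := by simp [ha]
  have ha0 : 0 ≤ (a : B) := by
    rw [hac]; exact Finset.sum_nonneg fun j _ => mul_star_self_nonneg _
  -- The `+ 1` avoids division by zero when `a = 0`; the scaling forces `b ≤ 1`.
  set s : ℝ := (‖(a : B)‖ + 1)⁻¹ with hs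
  have hspos : 0 < s := by positivity
  set b : A := (s : ℂ) • a with hb
  have hbJ : b ∈ J := J.smul_of_tower_mem _ haJ
  have hbc : (b : B) = s • (a : B) := by simp [hb]
  have hb0 : 0 ≤ (b : B) := by rw [hbc]; exact smul_nonneg hspos.le ha0
  have hb1 : (b : B) ≤ 1 := by
    rw [← CStarAlgebra.norm_le_one_iff_of_nonneg _ hb0, hbc, norm_smul,
      Real.norm_of_nonneg hspos.le, hs, inv_mul_le_iff₀ (by positivity)]
    linarith
  obtain ⟨n, hn⟩ := exists_nat_gt (1 / (s * ε ^ 2))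
  have hn' : (0 : ℝ) < n := lt_trans (by positivity) hn
  have hcoe : 1 - ((1 - (1 - b) ^ n : A) : B) = (1 - (b : B)) ^ n := by simp
  refine ⟨1 - (1 - b) ^ n, J.one_sub_one_sub_pow_mem hbJ n, ?_, ?_, fun j hj => ?_⟩
  · have : ((1 - (1 - b) ^ n : A) : B) = 1 - (1 - (b : B)) ^ n := by simp
    rw [this]
    exact (IsSelfAdjoint.one B).sub (((IsSelfAdjoint.one B).sub (.of_nonneg hb0)).pow n)
  · rw [hcoe]; exact norm_one_sub_pow_le_one hb0 hb1 n
  · rw [hcoe]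
    have hle : s • (((j : A) : B) * star ((j : A) : B)) ≤ b := by
      rw [hbc, hac]
      exact smul_le_smul_of_nonneg_left
        (Finset.single_le_sum (f := fun j : J => ((j : A) : B) * star ((j : A) : B))
          (fun j _ => mul_star_self_nonneg _) hj) hspos.le
    refine (sq_le_sq₀ (norm_nonneg _) hε.le).1 ?_
    refine (norm_one_sub_pow_mul_sq_le hspos hb0 hb1 hle (by exact_mod_cast hn')).trans ?_
    rw [div_lt_iff₀ (by positivity)] at hn
    rw [div_le_iff₀ (by positivity)]
    linarith

/-- A two-sided ideal of a `*`-subalgebra of a `C*`-algebra has a left approximate unit. -/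
theorem exists_ideal_approximateUnit (A : StarSubalgebra ℂ B) (J : Ideal A) [J.IsTwoSided] :
    ∃ u : Finset J × ℕ → J, (∀ i, IsSelfAdjoint ((u i : A) : B)) ∧
      (∀ i, ‖1 - ((u i : A) : B)‖ ≤ 1) ∧
      ∀ j : J, Tendsto (fun i => (1 - ((u i : A) : B)) * ((j : A) : B)) atTop (𝓝 0) := by
  have h (i : Finset J × ℕ) := exists_mem_ideal_norm_one_sub_mul_le A J i.1
    (Nat.one_div_pos_of_nat (α := ℝ) (n := i.2))
  choose u huJ husa hu1 hu using h
  refine ⟨fun i => ⟨u i, huJ i⟩, husa, hu1, fun j => ?_⟩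
  have hlim : Tendsto (fun i : Finset J × ℕ => 1 / ((i.2 : ℝ) + 1)) atTop (𝓝 0) := by
    rw [← prod_atTop_atTop_eq]
    exact tendsto_one_div_add_atTop_nhds_zero_nat.comp tendsto_snd
  refine squeeze_zero_norm' ?_ hlim
  filter_upwards [eventually_ge_atTop (({j} : Finset J), 0)] with i hi
  exact hu i j (hi.1 (Finset.mem_singleton_self j))

end ApproximateUnit

section EssentialSubspace

variable {H : Type*} [NormedAddCommGroup H] [InnerProductSpace ℂ H]

/-- A bounded net of operators converging to zero strongly on a dense subspace of `V` converges
to zero strongly on the closure of `V`. -/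
theorem tendsto_apply_zero_of_mem_closure {ι : Type*} {l : Filter ι} {T : ι → H →L[ℂ] H}
    (hT : ∀ i, ‖T i‖ ≤ 1) {V : Set H} (hV : ∀ x ∈ V, Tendsto (fun i => T i x) l (𝓝 0))
    {x : H} (hx : x ∈ closure V) : Tendsto (fun i => T i x) l (𝓝 0) := by
  rw [Metric.tendsto_nhds]
  intro ε hε
  obtain ⟨y, hy, hxy⟩ := Metric.mem_closure_iff.1 hx (ε / 2) (half_pos hε)
  filter_upwards [Metric.tendsto_nhds.1 (hV y hy) (ε / 2) (half_pos hε)] with i hi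
  rw [dist_zero_right] at hi ⊢
  rw [dist_eq_norm] at hxy
  calc ‖T i x‖ = ‖T i (x - y) + T i y‖ := by rw [← map_add, sub_add_cancel]
    _ ≤ ‖T i (x - y)‖ + ‖T i y‖ := norm_add_le _ _
    _ ≤ 1 * ‖x - y‖ + ‖T i y‖ := by gcongr; exact (T i).le_of_opNorm_le (hT i) _
    _ < ε := by linarith

/-- Composing a bounded strongly null net with a compact operator gives a norm null net. -/
theorem IsCompactOperator.tendsto_mul_zero {ι : Type*} {l : Filter ι} {T : ι → H →L[ℂ] H}
    (hT : ∀ i, ‖T i‖ ≤ 1) (hT0 : ∀ x, Tendsto (fun i => T i x) l (𝓝 0))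
    {K : H →L[ℂ] H} (hK : IsCompactOperator K) : Tendsto (fun i => T i * K) l (𝓝 0) := by
  have hcpt : IsCompact (closure (K '' Metric.closedBall 0 1)) :=
    IsCompactOperator.isCompact_closure_image_closedBall (f := (K : H →ₗ[ℂ] H)) hK 1
  rw [Metric.tendsto_nhds]
  intro ε hε
  -- Strong convergence is uniform on a finite net of the image of the ball; the bound on `‖T i‖`
  -- extends it to the whole image.
  obtain ⟨t, htfin, ht⟩ := Metric.totallyBounded_iff.1 hcpt.totallyBounded (ε / 4) (by positivity)
  have hev : ∀ᶠ i in l, ∀ y ∈ t, ‖T i y‖ < ε / 4 := by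
    rw [htfin.eventually_all]
    intro y _
    simpa using Metric.tendsto_nhds.1 (hT0 y) (ε / 4) (by positivity)
  filter_upwards [hev] with i hi
  rw [dist_zero_right]
  refine lt_of_le_of_lt (ContinuousLinearMap.opNorm_le_of_unit_norm (C := ε / 2) (by positivity)
    fun x hx => ?_) (by linarith)
  obtain ⟨y, hy, hxy⟩ : ∃ y ∈ t, K x ∈ Metric.ball y (ε / 4) := by
    simpa using ht (subset_closure ⟨x, by simp [hx], rfl⟩)
  rw [mem_ball_iff_norm] at hxy
  calc ‖(T i * K) x‖ = ‖T i (K x - y) + T i y‖ := by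
        rw [← map_add, sub_add_cancel, mul_apply_eq_comp]
    _ ≤ ‖T i (K x - y)‖ + ‖T i y‖ := norm_add_le _ _
    _ ≤ 1 * ‖K x - y‖ + ‖T i y‖ := by gcongr; exact (T i).le_of_opNorm_le (hT i) _
    _ ≤ ε / 2 := by linarith [hi y hy]

/-- The left annihilator of an operator is closed in the weak operator topology. -/
theorem mul_eq_zero_of_mem_wotClosure {V : Set (H →L[ℂ] H)} {e T : H →L[ℂ] H}
    (hV : ∀ A ∈ V, A * e = 0) (hT : T ∈ wotClosure V) : T * e = 0 := by
  ext x
  refine ext_inner_left ℂ fun y => ?_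
  have hclosed : IsClosed {A : H →WOT[ℂ] H | inner ℂ y (A (e x)) = 0} := by
    refine isClosed_eq ?_ continuous_const
    exact ContinuousLinearMapWOT.continuous_dual_apply (e x) (innerSL ℂ y)
  have hsub : (fun A : H →L[ℂ] H => (ContinuousLinearMapWOT.ofCLM A : H →WOT[ℂ] H)) '' V ⊆
      {A : H →WOT[ℂ] H | inner ℂ y (A (e x)) = 0} := by
    rintro _ ⟨A, hA, rfl⟩
    have : A (e x) = 0 := by simpa using congr($(hV A hA) x)
    simp [this]
  simpa using closure_minimal hsub hclosed hT

variable [CompleteSpace H]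

/-- Invariance gives `e * a * e = a * e`; the same for `star a`, after adjoints, gives `e * a * e =
e * a`. -/
theorem starProjection_mem_centralizer (A : StarSubalgebra ℂ (H →L[ℂ] H)) (M : Submodule ℂ H)
    [M.HasOrthogonalProjection] (hM : ∀ a ∈ A, ∀ x ∈ M, a x ∈ M) :
    M.starProjection ∈ Set.centralizer (A : Set (H →L[ℂ] H)) := by
  set e := M.starProjection
  have hsa : star e = e := isSelfAdjoint_starProjection M
  have key (a) (ha : a ∈ A) : e * (a * e) = a * e := by
    ext x
    exact Submodule.starProjection_eq_self_iff.2 (hM a ha _ (M.starProjection_apply_mem x))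
  intro a ha
  have h2 := congrArg star (key (star a) (star_mem ha))
  simp only [star_mul, star_star, hsa] at h2
  rw [← key a ha, ← mul_assoc, h2]

/-- The closed subspace spanned by the ranges of the operators in `J`. -/
noncomputable def essentialSubspace {A : StarSubalgebra ℂ (H →L[ℂ] H)} (J : Ideal A) :
    Submodule ℂ H :=
  (Submodule.span ℂ {y | ∃ j ∈ J, ∃ x, (j : H →L[ℂ] H) x = y}).topologicalClosure

instance {A : StarSubalgebra ℂ (H →L[ℂ] H)} (J : Ideal A) :
    CompleteSpace (essentialSubspace J) :=
  (Submodule.isClosed_topologicalClosure _).completeSpace_coe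

variable {A : StarSubalgebra ℂ (H →L[ℂ] H)} {J : Ideal A}

theorem apply_mem_essentialSubspace {j : A} (hj : j ∈ J) (x : H) :
    (j : H →L[ℂ] H) x ∈ essentialSubspace J :=
  Submodule.le_topologicalClosure _ (Submodule.subset_span ⟨j, hj, x, rfl⟩)

theorem starProjection_essentialSubspace_mul {j : A} (hj : j ∈ J) :
    (essentialSubspace J).starProjection * (j : H →L[ℂ] H) = j := by
  ext x
  exact Submodule.starProjection_eq_self_iff.2 (apply_mem_essentialSubspace hj x)

theorem starProjection_essentialSubspace_mem_centralizer :
    (essentialSubspace J).starProjection ∈ Set.centralizer (A : Set (H →L[ℂ] H)) := by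
  refine starProjection_mem_centralizer A _ fun a ha x hx => ?_
  refine map_mem_closure a.continuous hx fun y hy => ?_
  refine (Submodule.span_le (p := (Submodule.span ℂ _).comap (a : H →ₗ[ℂ] H))).2 ?_ hy
  rintro _ ⟨j, hj, z, rfl⟩
  exact Submodule.subset_span ⟨⟨a, ha⟩ * j, J.mul_mem_left _ hj, z, rfl⟩

/-- A closed two-sided ideal contains the products of the compact operators of the algebra with
the projection onto its essential subspace. -/
theorem starProjection_essentialSubspace_mul_mem [J.IsTwoSided] (hJ : IsClosed (J : Set A))
    (hA : IsClosed (A : Set (H →L[ℂ] H))) {K : H →L[ℂ] H} (hKA : K ∈ A)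
    (hK : IsCompactOperator K) :
    (essentialSubspace J).starProjection * K ∈
      (fun x : A => (x : H →L[ℂ] H)) '' (J : Set A) := by
  classical
  set e := (essentialSubspace J).starProjection
  obtain ⟨u, husa, hu1, hu⟩ := exists_ideal_approximateUnit A J
  have hue (i) : ((u i : A) : H →L[ℂ] H) * e = (u i : A) := by
    have h := congrArg star (starProjection_essentialSubspace_mul (u i).2)
    rwa [star_mul, (husa i).star_eq, (isSelfAdjoint_starProjection _).star_eq] at h
  -- This factorization reduces strong convergence on `H` to convergence on the essential subspace.
  have hdiff (i) : e - ((u i : A) : H →L[ℂ] H) = (1 - ((u i : A) : H →L[ℂ] H)) * e := by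
    rw [sub_mul, one_mul, hue]
  have hbound (i) : ‖e - ((u i : A) : H →L[ℂ] H)‖ ≤ 1 := by
    rw [hdiff]
    exact (norm_mul_le _ _).trans
      (mul_le_one₀ (hu1 i) (norm_nonneg _) (Submodule.starProjection_norm_le _))
  have hspan : ∀ y ∈ Submodule.span ℂ {y | ∃ j ∈ J, ∃ x, (j : H →L[ℂ] H) x = y},
      Tendsto (fun i => (1 - ((u i : A) : H →L[ℂ] H)) y) atTop (𝓝 0) := by
    intro y hy
    induction hy using Submodule.span_induction with
    | mem y hy =>
      obtain ⟨j, hj, x, rfl⟩ := hy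
      exact (((ContinuousLinearMap.apply ℂ H x).continuous.tendsto' 0 0 (by simp)).comp
        (hu ⟨j, hj⟩))
    | zero => simpa only [map_zero] using tendsto_const_nhds
    | add y z _ _ hy hz => simpa only [map_add, add_zero] using hy.add hz
    | smul c y _ hy => simpa only [map_smul, smul_zero] using hy.const_smul c
  have hstrong (x : H) : Tendsto (fun i => (e - ((u i : A) : H →L[ℂ] H)) x) atTop (𝓝 0) := by
    simp only [hdiff, mul_apply_eq_comp]
    exact tendsto_apply_zero_of_mem_closure hu1 hspan
      ((essentialSubspace J).starProjection_apply_mem x)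
  have hlim : Tendsto (fun i => ((u i : A) : H →L[ℂ] H) * K) atTop (𝓝 (e * K)) := by
    have h := (hK.tendsto_mul_zero hbound hstrong).const_sub (e * K)
    simpa only [sub_mul, sub_sub_cancel, sub_zero] using h
  have hclosed : IsClosed ((fun x : A => (x : H →L[ℂ] H)) '' (J : Set A)) :=
    hA.isClosedEmbedding_subtypeVal.isClosedMap _ hJ
  exact hclosed.mem_of_tendsto hlim (Eventually.of_forall fun i =>
    ⟨(u i : A) * ⟨K, hKA⟩, J.mul_mem_right _ (u i).2, rfl⟩)

end EssentialSubspace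

theorem theorem3 {H : Type*} [NormedAddCommGroup H] [InnerProductSpace ℂ H] [CompleteSpace H]
    (U : Submodule ℂ (H →L[ℂ] H)) (hU_closed : IsClosed (U : Set (H →L[ℂ] H)))
    (hU_unital : (1 : H →L[ℂ] H) ∈ U)
    (hS : ∃ S : Set (H →L[ℂ] H),
      S ⊆ {K : H →L[ℂ] H | IsCompactOperator K} ∩ (cstarGenerated U : Set (H →L[ℂ] H)) ∧
      S * Set.centralizer (cstarGenerated U : Set (H →L[ℂ] H)) ⊆ (U : Set (H →L[ℂ] H)) ∧
      (1 : H →L[ℂ] H) ∈ wotClosure (Submodule.span ℂ (S + star S) : Set (H →L[ℂ] H))) :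
    HasTrivialIntersectionProperty U := by
  obtain ⟨S, hSK, hSU, h1⟩ := hS
  intro J hJtwo hJ hUJ
  have hA : IsClosed (cstarGenerated U : Set (H →L[ℂ] H)) :=
    StarSubalgebra.isClosed_topologicalClosure _
  set e := (essentialSubspace J).starProjection with he
  have hecent := starProjection_essentialSubspace_mem_centralizer (J := J)
  have hesa : star e = e := isSelfAdjoint_starProjection _
  have hcomm (K) (hK : K ∈ S) : K * e = e * K := hecent K (hSK hK).2
  have hSe (K) (hK : K ∈ S) : K * e = 0 := by
    have hmem : K * e ∈ (U : Set (H →L[ℂ] H)) ∩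
        ((fun x : cstarGenerated U => (x : H →L[ℂ] H)) '' J) := by
      refine ⟨hSU (Set.mul_mem_mul hK hecent), ?_⟩
      rw [hcomm K hK]
      exact starProjection_essentialSubspace_mul_mem hJ hA (hSK hK).2 (hSK hK).1
    rwa [hUJ] at hmem
  have hspan : ∀ T ∈ (Submodule.span ℂ (S + star S) : Set (H →L[ℂ] H)), T * e = 0 := by
    intro T hT
    induction hT using Submodule.span_induction with
    | mem T hT =>
      obtain ⟨K, hK, L, hL, rfl⟩ := Set.mem_add.1 hT
      have hLe : L * e = 0 := by
        -- Here `star L ∈ S`, so `e * star L = 0`, whose adjoint is the goal.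
        have h := congrArg star ((hcomm _ hL).symm.trans (hSe _ hL))
        simpa [hesa] using h
      rw [add_mul, hSe K hK, hLe, add_zero]
    | zero => exact zero_mul e
    | add S T _ _ hS hT => rw [add_mul, hS, hT, add_zero]
    | smul c T _ hT => rw [smul_mul_assoc, hT, smul_zero]
  have he0 : e = 0 := by simpa using mul_eq_zero_of_mem_wotClosure hspan h1
  rw [eq_bot_iff]
  intro j hj
  have h := starProjection_essentialSubspace_mul hj
  rw [← he, he0, zero_mul] at h
  exact Subtype.ext h.symm
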